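/- All graphs are nonempty, finite and simple. A *DP-cover* of a graph $G$ is a pair $(L,H)$, where $H$ is a graph and $L$ assigns to each $v\in V(G)$ a set $L(v)\subseteq V(H)$, such that the sets $L(v)$ are pairwise disjoint, independent in $H$, and have union $V(H)$, and such that for all $u\neq v$, if $E_H(L(u),L(v))\neq\emptyset$ then $uv\in E(G)$ and $E_H(L(u),L(v))$ is a (not necessarily perfect) matching. It is *$q$-fold* if $|L(v)|=q$ for every $v$; an *$(L,H)$-coloring* is an independent set $I$ of $H$ with $|I\cap L(v)|=1$ for every $v\in V(G)$. The *DP-chromatic number* $\chi_{DP}(G)$ is the smallest $q\in\mathbb{N}$ such that every $q$-fold DP-cover $(L,H)$ of $G$ admits an $(L,H)$-coloring. A graph is *$k$-critical* ($k\ge 2$) if its chromatic number is $k$ and every proper subgraph has chromatic number less than $k$. $P(G,q)$ is the number of proper $q$-colorings of $G$ (the chromatic polynomial), $\square$ is the Cartesian product of graphs, and $K_{l,t}$ is the complete bipartite graph with parts of sizes $l$ and $t$. **Theorem 1.10.** Let $k\ge 2$ and let $G$ be a $k$-critical graph with $\chi_{DP}(G)=k$. For $l\ge 2$, let $$c_{k,l}=\left\lceil\frac{l\ln(k+l-1)}{\ln((k-1)!)+l\ln(k+l-1)-\ln\bigl((k-1)!\,(k+l-1)^l-(k+l-1)!\bigr)}\right\rceil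 .$$ Then $\chi_{DP}(G\,\square\,K_{l,t})=k+l$ for every natural number $t$ with $$t\ \ge\ c_{k,l}\left(\frac{P(G,k+l-1)}{k+l-1}\right)^{l}.$$ Consequently, $\chi_{DP}(G\,\square\,K_{l,t})=k+l$ for every natural number $t$ with $$t\ \ge\ \left(\frac{l\,(k-1)!\,\ln(k+l-1)}{(k+l-1)!}\right)\bigl(P(G,k+l-1)\bigr)^{l}.$$ -/

import Mathlib

open scoped Nat

universe u

namespace SimpleGraph

variable {V : Type u}

/-- A graph `G` is `k`-critical (a notion used for `2 ≤ k`): its chromatic number is `k`, and every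
proper subgraph (not necessarily induced) has chromatic number less than `k`. -/
def IsKCritical (G : SimpleGraph V) (k : ℕ) : Prop :=
  G.chromaticNumber = k ∧
    ∀ G' : G.Subgraph, G' ≠ ⊤ → G'.coe.chromaticNumber < k

/-- `P(G, q)`: the number of proper `q`-colorings of `G`. -/
noncomputable def chromaticPoly (G : SimpleGraph V) (q : ℕ) : ℕ :=
  Nat.card (G.Coloring (Fin q))

/-- A DP-cover `(L, H)` of `G`; the vertices of `H` (the colors) are the elements of `C`. -/
structure DPCover (G : SimpleGraph V) (C : Type u) where
  /-- the graph on the colors -/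
  H : SimpleGraph C
  /-- the list of colors of each vertex -/
  L : V → Set C
  disjoint : ∀ u v, u ≠ v → Disjoint (L u) (L v)
  indep : ∀ v, H.IsIndepSet (L v)
  cover : ⋃ v, L v = Set.univ
  /-- color edges run only between the lists of adjacent vertices -/
  adj_of_adj : ∀ u v, u ≠ v → ∀ c ∈ L u, ∀ d ∈ L v, H.Adj c d → G.Adj u v
  /-- the edges between two lists form a matching: no color of `L u` has two neighbors in `L v`
  (exchanging `u` and `v` gives the same at the other end) -/
  matching : ∀ u v, u ≠ v → ∀ c ∈ L u, ∀ d ∈ L v, ∀ d' ∈ L v, H.Adj c d → H.Adj c d' → d = d'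

/-- The cover is `k`-fold: every list has exactly `k` elements. -/
def DPCover.IsFold {G : SimpleGraph V} {C : Type u} (𝓗 : G.DPCover C) (k : ℕ) : Prop :=
  ∀ v, (𝓗.L v).encard = k

/-- `I` is an `𝓗`-coloring: an independent set of colors that meets every list in exactly one
color. As the lists partition the colors, such an `I` has exactly `|V|` elements. -/
def DPCover.IsColoring {G : SimpleGraph V} {C : Type u} (𝓗 : G.DPCover C) (I : Set C) : Prop :=
  𝓗.H.IsIndepSet I ∧ ∀ v, (I ∩ 𝓗.L v).encard = 1

/-- Every `k`-fold cover of `G` admits a coloring. (A `k`-fold cover of a finite graph has finitely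
many colors, and relabeling them changes nothing, so the universe of `C` is immaterial.) -/
def DPColorable (G : SimpleGraph V) (k : ℕ) : Prop :=
  ∀ (C : Type u) (𝓗 : G.DPCover C), 𝓗.IsFold k → ∃ I : Set C, 𝓗.IsColoring I

/-- The DP-chromatic number: the smallest `k` such that every `k`-fold cover admits a coloring
(`⊤` if there is none, which does not happen for finite graphs). -/
noncomputable def dpChromaticNumber (G : SimpleGraph V) : ℕ∞ :=
  ⨅ k ∈ {k : ℕ | G.DPColorable k}, (k : ℕ∞)

end SimpleGraph

/-- The constant `c_{k,l}`, for `2 ≤ k` and `2 ≤ l`. -/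
noncomputable def dpConst (k l : ℕ) : ℤ :=
  ⌈(l * Real.log (k + l - 1)) /
    (Real.log ((k - 1)! : ℕ) + l * Real.log (k + l - 1)
      - Real.log (((k - 1)! : ℕ) * ((k : ℝ) + l - 1) ^ l - ((k + l - 1)! : ℕ)))⌉

/-!
Write `q = k + l - 1` and let `r = P(G, q) / q`.

*Upper bound.* Given a `(k + l)`-fold cover of `G □ K_{l,t}`, color the `l` copies of `G` over one
side arbitrarily. Every vertex of the other `t` copies has just `l` neighbors in these, so it keeps
at least `k` of its colors, and `χ_DP(G) = k` colors each of the `t` copies from what is left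
(`SimpleGraph.DPColorable.boxProd_completeBipartiteGraph`).

*Lower bound.* Use a `q`-fold cover whose matchings are translations of `ℤ/q`: the identity inside
each copy of `G`, so that colorings there are proper `q`-colorings of `G`. A proper coloring is,
uniquely, a translate of one that vanishes at a fixed vertex, and there are `r` of the latter. Reserve
`c` of the `t` copies for each `l`-tuple of normalized colorings `rᵢ`, and match copy `i` to the
`m`-th of these by `x ↦ x - rᵢ(v) + T m i` at the vertex `v`. If copy `i` is colored `rᵢ + sᵢ`, then
it forbids the same color `sᵢ + T m i` at every vertex of that copy; if these `l` colors are
distinct, a coloring of the copy would color `G` with `k - 1 < χ(G)` colors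
(`SimpleGraph.not_dpColorable_boxProd`). So `c * r ^ l` copies suffice if there are `c` translations
`T m` such that every `s` has an injective translate `s + T m`. With `N` the number of noninjective
`l`-tuples, `q ^ l * N ^ c ≤ (q ^ l) ^ c` is enough, by averaging
(`exists_translations_avoiding`).

*The constants.* Taking logarithms, this inequality says that `c` is at least the quotient whose
ceiling is `dpConst k l`. The second bound on `t` is weaker than the first, ceiling included, because
`2 y / (y + 2) ≤ log (1 + y)` leaves a slack of `l * log q / 2 ≥ 1` (`dpConst_succ_le`).
-/

/-! ### Independent transversals and the upper bound -/

namespace SimpleGraph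

section Transversals

variable {V : Type u} {G : SimpleGraph V}

/-- Colorings of a cover, in functional form: independent transversals of the lists. -/
theorem DPCover.exists_isColoring_iff {C : Type u} (𝓗 : G.DPCover C) :
    (∃ I, 𝓗.IsColoring I) ↔
      ∃ f : V → C, (∀ v, f v ∈ 𝓗.L v) ∧ ∀ u v, ¬ 𝓗.H.Adj (f u) (f v) := by
  constructor
  · rintro ⟨I, hI, h1⟩
    have h (v : V) : ∃ c, c ∈ I ∩ 𝓗.L v := by
      obtain ⟨c, hc⟩ := Set.encard_eq_one.1 (h1 v)
      exact ⟨c, by simp [hc]⟩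
    choose f hf using h
    refine ⟨f, fun v => (hf v).2, fun u v huv => ?_⟩
    exact hI (hf u).1 (hf v).1 huv.ne huv
  · rintro ⟨f, hf, hadj⟩
    refine ⟨Set.range f, ?_, fun v => Set.encard_eq_one.2 ⟨f v, ?_⟩⟩
    · rintro _ ⟨u, rfl⟩ _ ⟨v, rfl⟩ -
      exact hadj u v
    · ext c
      constructor
      · rintro ⟨⟨u, rfl⟩, hu⟩
        by_cases huv : u = v
        · simp [huv]
        · exact absurd hu (Set.disjoint_left.1 (𝓗.disjoint u v huv) (hf u))
      · rintro rfl
        exact ⟨⟨v, rfl⟩, hf v⟩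

/-- The lists need not cover all of `H`, nor have exactly `m` elements: passing to `m`-element sublists
and to the part of `H` they span gives an `m`-fold cover. -/
theorem DPColorable.exists_transversal {m : ℕ} (h : G.DPColorable m) {C : Type u}
    (H : SimpleGraph C) (S : V → Set C) (disj : ∀ u v, u ≠ v → Disjoint (S u) (S v))
    (indep : ∀ v, H.IsIndepSet (S v))
    (adj : ∀ u v, u ≠ v → ∀ c ∈ S u, ∀ d ∈ S v, H.Adj c d → G.Adj u v)
    (matching : ∀ u v, u ≠ v → ∀ c ∈ S u, ∀ d ∈ S v, ∀ d' ∈ S v,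
      H.Adj c d → H.Adj c d' → d = d')
    (card : ∀ v, (m : ℕ∞) ≤ (S v).encard) :
    ∃ f : V → C, (∀ v, f v ∈ S v) ∧ ∀ u v, ¬ H.Adj (f u) (f v) := by
  choose R hRS hR using fun v => Set.exists_subset_encard_eq (card v)
  let 𝓗 : G.DPCover {c : C // ∃ v, c ∈ R v} :=
    { H := H.comap Subtype.val
      L := fun v => Subtype.val ⁻¹' R v
      disjoint := fun u v huv =>
        ((disj u v huv).mono (hRS u) (hRS v)).preimage _
      indep := fun v c hc d hd hcd hadj =>
        indep v (hRS v hc) (hRS v hd) (fun e => hcd (Subtype.ext e)) hadj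
      cover := by
        ext ⟨c, v, hv⟩
        simpa using ⟨v, hv⟩
      adj_of_adj := fun u v huv c hc d hd hadj =>
        adj u v huv c (hRS u hc) d (hRS v hd) hadj
      matching := fun u v huv c hc d hd d' hd' h₁ h₂ => Subtype.ext <|
        matching u v huv c (hRS u hc) d (hRS v hd) d' (hRS v hd') h₁ h₂ }
  have hfold : 𝓗.IsFold m := fun v => by
    change (Subtype.val ⁻¹' R v : Set {c : C // ∃ v, c ∈ R v}).encard = m
    rw [Set.encard_preimage_of_injective_subset_range Subtype.val_injective, hR]
    intro c hc
    simpa using ⟨v, hc⟩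
  obtain ⟨f, hf, hadj⟩ := 𝓗.exists_isColoring_iff.1 (h _ 𝓗 hfold)
  exact ⟨fun v => f v, fun v => hRS v (hf v), hadj⟩

theorem DPColorable.mono {m n : ℕ} (h : G.DPColorable m) (hmn : m ≤ n) : G.DPColorable n := by
  intro C 𝓗 hfold
  refine 𝓗.exists_isColoring_iff.2 (h.exists_transversal 𝓗.H 𝓗.L 𝓗.disjoint 𝓗.indep
    𝓗.adj_of_adj 𝓗.matching fun v => ?_)
  rw [hfold v]
  exact_mod_cast hmn

theorem dpColorable_of_dpChromaticNumber_eq {k : ℕ} (h : G.dpChromaticNumber = k) :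
    G.DPColorable k := by
  by_contra hk
  have : ((k + 1 : ℕ) : ℕ∞) ≤ G.dpChromaticNumber := by
    refine le_iInf₂ fun m (hm : G.DPColorable m) => ?_
    have : ¬ m ≤ k := fun hmk => hk (hm.mono hmk)
    exact_mod_cast (by omega : k + 1 ≤ m)
  rw [h] at this
  have : k + 1 ≤ k := by exact_mod_cast this
  omega

theorem dpChromaticNumber_eq_succ {n : ℕ} (h : G.DPColorable (n + 1)) (h' : ¬ G.DPColorable n) :
    G.dpChromaticNumber = ((n + 1 : ℕ) : ℕ∞) := by
  refine le_antisymm (iInf₂_le (n + 1) h) (le_iInf₂ fun m (hm : G.DPColorable m) => ?_)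
  have : ¬ m ≤ n := fun hmn => h' (hm.mono hmn)
  exact_mod_cast (by omega : n + 1 ≤ m)

/-- The colors of the copies of `G` over the side of size `l` can be chosen freely; each vertex of
a copy over the other side then loses at most one color to each of its `l` neighbors there. -/
theorem DPColorable.boxProd_completeBipartiteGraph {k : ℕ} (h : G.DPColorable k) (l t : ℕ) :
    (G □ completeBipartiteGraph (Fin l) (Fin t)).DPColorable (k + l) := by
  intro C 𝓗 hfold
  rw [𝓗.exists_isColoring_iff]
  have copy (b : Fin l ⊕ Fin t) (S : V → Set C) (hS : ∀ v, S v ⊆ 𝓗.L (v, b))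
      (hcard : ∀ v, (k : ℕ∞) ≤ (S v).encard) :
      ∃ f : V → C, (∀ v, f v ∈ S v) ∧ ∀ u v, ¬ 𝓗.H.Adj (f u) (f v) := by
    have ne {u v : V} (huv : u ≠ v) : (u, b) ≠ (v, b) := fun e => huv (Prod.ext_iff.1 e).1
    refine h.exists_transversal 𝓗.H S
      (fun u v huv => (𝓗.disjoint _ _ (ne huv)).mono (hS u) (hS v))
      (fun v => (𝓗.indep (v, b)).mono (hS v)) (fun u v huv c hc d hd hadj => ?_)
      (fun u v huv c hc d hd d' hd' => 𝓗.matching _ _ (ne huv) c (hS u hc) d (hS v hd) d'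
        (hS v hd')) hcard
    simpa [boxProd_adj] using 𝓗.adj_of_adj _ _ (ne huv) c (hS u hc) d (hS v hd) hadj
  choose f hf hfadj using fun i : Fin l => copy (Sum.inl i) (fun v => 𝓗.L (v, Sum.inl i))
    (fun v => subset_rfl) (fun v => by rw [hfold]; exact_mod_cast Nat.le_add_right k l)
  let N (v : V) (j : Fin t) (i : Fin l) : Set C := {c ∈ 𝓗.L (v, Sum.inr j) | 𝓗.H.Adj (f i v) c}
  have hN (v j) : (⋃ i, N v j i).encard ≤ l := by
    have hi (i : Fin l) : (N v j i).encard ≤ 1 := Set.encard_le_one_iff.2 fun c d hc hd =>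
      𝓗.matching (v, Sum.inl i) (v, Sum.inr j) (by simp) _ (hf i v) _ hc.1 _ hd.1 hc.2 hd.2
    calc (⋃ i, N v j i).encard ≤ ∑ i, (N v j i).encard := by
          classical
          have key (s : Finset (Fin l)) :
              (⋃ i ∈ s, N v j i).encard ≤ ∑ i ∈ s, (N v j i).encard := by
            induction s using Finset.induction_on with
            | empty => simp
            | insert a s ha ih =>
              rw [Finset.set_biUnion_insert, Finset.sum_insert ha]
              exact (Set.encard_union_le _ _).trans (by gcongr)
          simpa using key Finset.univ
      _ ≤ ∑ _i : Fin l, 1 := Finset.sum_le_sum fun i _ => hi i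
      _ = l := by simp
  choose g hg hgadj using fun j : Fin t => copy (Sum.inr j)
    (fun v => 𝓗.L (v, Sum.inr j) \ ⋃ i, N v j i) (fun v => Set.sdiff_subset) (fun v => by
      have h1 := Set.encard_le_encard_sdiff_add_encard (𝓗.L (v, Sum.inr j)) (⋃ i, N v j i)
      rw [hfold] at h1
      have h2 := h1.trans (add_le_add_right (hN v j) _)
      push_cast at h2
      exact (ENat.add_le_add_iff_right (ENat.natCast_ne_top l)).1 h2)
  have cross (v i j) : ¬ 𝓗.H.Adj (f i v) (g j v) := fun hadj =>
    (hg j v).2 (Set.mem_iUnion.2 ⟨i, (hg j v).1, hadj⟩)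
  let F : V × (Fin l ⊕ Fin t) → C := fun w => Sum.elim (fun i => f i w.1) (fun j => g j w.1) w.2
  have hF (w) : F w ∈ 𝓗.L w := by
    obtain ⟨v, i | j⟩ := w
    exacts [hf i v, (hg j v).1]
  refine ⟨F, hF, fun w w' hadj => ?_⟩
  have hne : w ≠ w' := by
    rintro rfl
    exact hadj.ne rfl
  have := 𝓗.adj_of_adj w w' hne _ (hF w) _ (hF w') hadj
  obtain ⟨v, b⟩ := w
  obtain ⟨v', b'⟩ := w'
  rw [boxProd_adj] at this
  obtain ⟨-, rfl⟩ | ⟨hb, rfl⟩ := this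
  · obtain i | j := b
    exacts [hfadj i v v' hadj, hgadj j v v' hadj]
  · obtain i | j := b <;> obtain i' | j' := b'
    · simp at hb
    · exact cross v i j' hadj
    · exact cross v i' j hadj.symm
    · simp at hb

end Transversals

/-! ### Covers by translations of an abelian group -/

section Shifts

variable {W : Type u} {Γ : SimpleGraph W} {A : Type} [AddCommGroup A]

/-- The cover with list `{w} × A` at each vertex `w`, in which, along each edge `uw`, the color `x`
of `u` is matched to the color `x + δ u w` of `w`. -/
def shiftCover (Γ : SimpleGraph W) (δ : W → W → A) (hδ : ∀ u w, δ w u = -δ u w) :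
    Γ.DPCover (W × A) where
  H :=
    { Adj := fun c d => Γ.Adj c.1 d.1 ∧ d.2 = c.2 + δ c.1 d.1
      symm := ⟨fun c d h => ⟨h.1.symm, by rw [h.2, hδ]; abel⟩⟩
      loopless := ⟨fun c h => h.1.ne rfl⟩ }
  L w := {c | c.1 = w}
  disjoint u w huw := Set.disjoint_left.2 fun c hc hc' => huw (hc.symm.trans hc')
  indep w c hc d hd _ h := h.1.ne (hc.trans hd.symm)
  cover := by ext c; simp
  adj_of_adj := by
    rintro u w - c rfl d rfl h
    exact h.1
  matching := by
    rintro u w - c rfl d rfl d' hd' h h'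
    exact Prod.ext hd'.symm (by rw [h.2, h'.2, show d'.1 = d.1 from hd'])

/-- A coloring of a shift cover is a map that avoids, along every edge, the prescribed difference. -/
theorem DPColorable.exists_shift_coloring [Finite A] (h : Γ.DPColorable (Nat.card A))
    (δ : W → W → A) (hδ : ∀ u w, δ w u = -δ u w) :
    ∃ g : W → A, ∀ u w, Γ.Adj u w → g w ≠ g u + δ u w := by
  have hfold : (shiftCover Γ δ hδ).IsFold (Nat.card A) := fun w => by
    have : (shiftCover Γ δ hδ).L w = Set.range fun a : A => (w, a) := by
      ext ⟨w', a⟩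
      simp [shiftCover, eq_comm]
    rw [this, ← Set.image_univ, Function.Injective.encard_image fun a b hab => (Prod.ext_iff.1 hab).2,
      Set.encard_univ, ENat.card_eq_coe_natCard]
  obtain ⟨f, hf, hadj⟩ := (DPCover.exists_isColoring_iff _).1 (h _ _ hfold)
  refine ⟨fun w => (f w).2, fun u w huw e => hadj u w ?_⟩
  have hu : (f u).1 = u := hf u
  have hw : (f w).1 = w := hf w
  exact ⟨by rwa [hu, hw], by rw [hu, hw]; exact e⟩

end Shifts

/-! ### Proper colorings up to translation -/

section Normalized

variable {V : Type u} (G : SimpleGraph V) (A : Type)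

/-- The proper colorings of `G` by elements of a group `A` that give the vertex `v₀` color `0`:
one from each class of colorings under translation. -/
abbrev NormalizedColoring [Zero A] (v₀ : V) := {r : G.Coloring A // r v₀ = 0}

/-- The translate of a proper coloring by `a`. -/
def Coloring.translate {G : SimpleGraph V} {A : Type} [AddCommGroup A] (f : G.Coloring A) (a : A) :
    G.Coloring A :=
  Coloring.mk (fun v => f v + a) fun huv e => f.valid huv (add_right_cancel e)

@[simp]
theorem Coloring.translate_apply {G : SimpleGraph V} {A : Type} [AddCommGroup A]
    (f : G.Coloring A) (a : A) (v : V) : f.translate a v = f v + a := rfl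

/-- A proper coloring is a normalized one translated by its color at `v₀`. -/
def coloringEquivNormalizedProd [AddCommGroup A] (v₀ : V) :
    G.Coloring A ≃ G.NormalizedColoring A v₀ × A where
  toFun f := (⟨f.translate (-f v₀), by simp⟩, f v₀)
  invFun p := p.1.1.translate p.2
  left_inv f := by
    apply DFunLike.ext
    intro v
    simp
  right_inv := by
    rintro ⟨⟨r, hr⟩, a⟩
    refine Prod.ext (Subtype.ext (DFunLike.ext _ _ fun v => ?_)) ?_ <;> simp [hr]

theorem chromaticPoly_eq_card_normalizedColoring_mul (v₀ : V) (q : ℕ) [NeZero q] :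
    G.chromaticPoly q = Nat.card (G.NormalizedColoring (ZMod q) v₀) * q := by
  have e : Fin q ≃ ZMod q := Fintype.equivOfCardEq (by simp [ZMod.card])
  have e' : G.Coloring (Fin q) ≃ G.Coloring (ZMod q) :=
    { toFun := fun f => Coloring.mk (fun v => e (f v)) fun huv he =>
        f.valid huv (e.injective he)
      invFun := fun f => Coloring.mk (fun v => e.symm (f v)) fun huv he =>
        f.valid huv (e.symm.injective he)
      left_inv := fun f => DFunLike.ext _ _ fun v => e.symm_apply_apply (f v)
      right_inv := fun f => DFunLike.ext _ _ fun v => e.apply_symm_apply (f v) }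
  rw [chromaticPoly, Nat.card_congr (e'.trans (G.coloringEquivNormalizedProd (ZMod q) v₀)),
    Nat.card_prod, Nat.card_zmod]

end Normalized

end SimpleGraph

/-! ### Translating all tuples to injective ones -/

section Translates

/-- Averaged over all families `T` of `c` translations, the number of `s` with every `s + T m` in `S`
is at most `1`. For `T = 0` it is `#S > 1`, so it vanishes for some `T`. The averaging alone would
not do if the average is exactly `1`, as happens for `c = 2` and noninjective pairs. -/
theorem exists_translations_avoiding {B : Type*} [AddCommGroup B] [Fintype B] [DecidableEq B]
    (S : Finset B) {c : ℕ} (hc : Fintype.card B * S.card ^ c ≤ Fintype.card B ^ c)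
    (hS : 2 ≤ S.card) : ∃ T : Fin c → B, ∀ s, ∃ m, s + T m ∉ S := by
  by_contra! hcon
  let P : (Fin c → B) → B → Prop := fun T s => ∀ m, s + T m ∈ S
  have hfiber (s : B) : (Finset.univ.filter fun T => P T s).card = S.card ^ c := by
    have : (Finset.univ.filter fun T => P T s) =
        Fintype.piFinset fun _ : Fin c => S.image (-s + ·) := by
      ext T
      simp only [P, Finset.mem_filter, Finset.mem_univ, true_and, Fintype.mem_piFinset,
        Finset.mem_image]
      refine forall_congr' fun m => ⟨fun h => ⟨_, h, by abel⟩, ?_⟩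
      rintro ⟨x, hx, e⟩
      rw [← e]
      simpa using hx
    rw [this, Fintype.card_piFinset_const, Finset.card_image_of_injective _ (add_right_injective _)]
  have hsum : ∑ T : Fin c → B, (Finset.univ.filter fun s => P T s).card =
      Fintype.card B * S.card ^ c := by
    have := Finset.sum_card_bipartiteAbove_eq_sum_card_bipartiteBelow
      (s := (Finset.univ : Finset (Fin c → B))) (t := (Finset.univ : Finset B)) P
    simp only [Finset.bipartiteAbove, Finset.bipartiteBelow] at this
    rw [this, Finset.sum_congr rfl fun s _ => hfiber s]
    simp
  have hlt : ∑ _T : Fin c → B, 1 < ∑ T : Fin c → B, (Finset.univ.filter fun s => P T s).card := by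
    refine Finset.sum_lt_sum (fun T _ => ?_) ⟨0, Finset.mem_univ _, ?_⟩
    · obtain ⟨s, hs⟩ := hcon T
      exact Finset.card_pos.2 ⟨s, by simpa [P] using hs⟩
    · refine lt_of_lt_of_le hS (Finset.card_le_card fun s hs => ?_)
      simp [P, hs]
  rw [hsum] at hlt
  exact absurd hc (by simpa using hlt)

/-- The number `q ^ l - q (q - 1) ⋯ (q - l + 1)` of `l`-tuples in a `q`-element set with a
repetition. -/
def repeatCount (q l : ℕ) : ℕ := q ^ l - q.descFactorial l

theorem card_filter_not_injective {A : Type*} [Fintype A] [DecidableEq A] (l : ℕ)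
    [DecidablePred fun x : Fin l → A => ¬ Function.Injective x] :
    (Finset.univ.filter fun x : Fin l → A => ¬ Function.Injective x).card =
      repeatCount (Fintype.card A) l := by
  classical
  have h := Finset.card_filter_add_card_filter_not (s := (Finset.univ : Finset (Fin l → A)))
    (fun x => Function.Injective x)
  have h' : (Finset.univ.filter fun x : Fin l → A => Function.Injective x).card =
      (Fintype.card A).descFactorial l := by
    rw [← Fintype.card_subtype, Fintype.card_congr (Equiv.subtypeInjectiveEquivEmbedding _ _),
      Fintype.card_embedding_eq, Fintype.card_fin]
  rw [h', Finset.card_univ, Fintype.card_fun, Fintype.card_fin] at h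
  rw [repeatCount, ← h, Nat.add_sub_cancel_left]

theorem le_repeatCount {q l : ℕ} (hl : 2 ≤ l) : q ≤ repeatCount q l := by
  classical
  have h := card_filter_not_injective (A := Fin q) l
  rw [Fintype.card_fin] at h
  rw [← h]
  refine (Finset.card_fin q).ge.trans (Finset.card_le_card_of_injOn (fun a _ => a) (fun a _ => ?_) fun a _ b _ hab => ?_)
  · simp only [Finset.coe_filter, Finset.mem_univ, true_and, Set.mem_ofPred_eq]
    intro hinj
    have := @hinj ⟨0, by omega⟩ ⟨1, by omega⟩ rfl
    simp at this
  · exact congrFun hab ⟨0, by omega⟩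

end Translates

/-! ### The lower bound -/

namespace SimpleGraph

variable {V : Type u} {G : SimpleGraph V}

/-- Each tuple of normalized colorings of the `l` copies of `G` gets `c` of the `t` copies, which
together obstruct every translate of that tuple. -/
theorem not_dpColorable_boxProd [Fintype V] {k l c t : ℕ} [NeZero (k + l)] (hl : 2 ≤ l)
    (hG : ¬ G.Colorable k) (v₀ : V)
    (hc : (k + l) ^ l * repeatCount (k + l) l ^ c ≤ ((k + l) ^ l) ^ c)
    (ht : c * Nat.card (G.NormalizedColoring (ZMod (k + l)) v₀) ^ l ≤ t) :
    ¬ (G □ completeBipartiteGraph (Fin l) (Fin t)).DPColorable (k + l) := by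
  classical
  intro hcol
  set q := k + l with hq
  let R := G.NormalizedColoring (ZMod q) v₀
  have : Finite (G.Coloring (ZMod q)) := DFunLike.finite _
  have : Fintype R := Fintype.ofFinite R
  obtain ⟨T, hT⟩ := exists_translations_avoiding (B := Fin l → ZMod q)
    (Finset.univ.filter fun x => ¬ Function.Injective x) (c := c)
    (by rw [card_filter_not_injective]; simpa [ZMod.card] using hc)
    (by
      rw [card_filter_not_injective, ZMod.card]
      exact le_trans (by omega) (le_repeatCount hl))
  simp only [Finset.mem_filter, Finset.mem_univ, true_and, not_not] at hT
  obtain ⟨e⟩ : Nonempty (Fin c × (Fin l → R) ↪ Fin t) :=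
    Function.Embedding.nonempty_of_card_le (by
      simpa [Nat.card_eq_fintype_card] using ht)
  -- Copies outside the range of `e` are not needed; any matchings do there.
  let D : Fin t → Fin l → V → ZMod q := Function.extend e (fun p i v => T p.1 i - (p.2 i).1 v) 0
  let δ : V × (Fin l ⊕ Fin t) → V × (Fin l ⊕ Fin t) → ZMod q := fun x y =>
    match x, y with
    | (v, .inl i), (_, .inr j) => D j i v
    | (_, .inr j), (v, .inl i) => -D j i v
    | _, _ => 0
  have hδ (x y) : δ y x = -δ x y := by
    obtain ⟨v, i | j⟩ := x <;> obtain ⟨v', i' | j'⟩ := y <;> simp [δ]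
  obtain ⟨g, hg⟩ := DPColorable.exists_shift_coloring (A := ZMod q) (by simpa using hcol) δ hδ
  let f (i : Fin l) : G.Coloring (ZMod q) := Coloring.mk (fun v => g (v, .inl i))
    fun {u v} huv h => hg (u, .inl i) (v, .inl i) (by simpa [boxProd_adj] using huv)
      (by simpa [δ] using h.symm)
  obtain ⟨m, hm⟩ := hT fun i => f i v₀
  let j := e (m, fun i => (G.coloringEquivNormalizedProd (ZMod q) v₀ (f i)).1)
  have hD (i v) : g (v, .inl i) + D j i v = f i v₀ + T m i := by
    have : D j = _ := e.injective.extend_apply _ _ _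
    rw [this]
    simp only [coloringEquivNormalizedProd, Equiv.coe_fn_mk, Coloring.translate_apply]
    change f i v + _ = _
    abel
  have havoid (v i) : g (v, .inr j) ≠ f i v₀ + T m i := by
    rw [← hD i v]
    exact hg (v, .inl i) (v, .inr j) (by simp [boxProd_adj])
  let X : Finset (ZMod q) := Finset.univ.image fun i => f i v₀ + T m i
  have hX : X.card = l := by
    exact (Finset.card_image_of_injective _ hm).trans (Finset.card_fin l)
  -- The copy `j` avoids `X` at every vertex, which leaves only `k` colors for it.
  let h : G.Coloring {x // x ∉ X} := Coloring.mk
    (fun v => ⟨g (v, .inr j), fun hv => by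
      obtain ⟨i, -, hi⟩ := Finset.mem_image.1 hv
      exact havoid v i hi.symm⟩)
    fun {u v} huv h => hg (u, .inr j) (v, .inr j) (by simpa [boxProd_adj] using huv)
      (by simpa [δ] using (Subtype.ext_iff.1 h).symm)
  apply hG
  have hcard : Fintype.card {x // x ∉ X} = k := by
    rw [Fintype.card_subtype_compl, ZMod.card, Fintype.card_coe, hX, hq, Nat.add_sub_cancel]
  exact hcard ▸ h.colorable

end SimpleGraph

/-! ### Numerical estimates -/

section Estimates

theorem card_bound_of_log_le {q l c N : ℕ} (hq : 0 < q) (hN : 0 < N)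
    (h : l * Real.log q ≤ c * (l * Real.log q - Real.log N)) :
    q ^ l * N ^ c ≤ (q ^ l) ^ c := by
  have hq' : (0 : ℝ) < q := by exact_mod_cast hq
  have hN' : (0 : ℝ) < N := by exact_mod_cast hN
  have : (q : ℝ) ^ l * (N : ℝ) ^ c ≤ ((q : ℝ) ^ l) ^ c := by
    rw [← Real.log_le_log_iff (by positivity) (by positivity),
      Real.log_mul (by positivity) (by positivity)]
    simp only [Real.log_pow]
    linarith
  exact_mod_cast this

/-- The bound `2 y / (y + 2) ≤ log (1 + y)` makes the quotient at most the right-hand side minus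
`L / 2`, which is room enough for the ceiling. -/
theorem ceil_div_log_one_add_le {L y : ℝ} (hL : 2 ≤ L) (hy : 0 < y) :
    (⌈L / Real.log (1 + y)⌉ : ℝ) ≤ L * (1 + y) / y := by
  have hlog := Real.le_log_one_add_of_nonneg hy.le
  have h1 : L / Real.log (1 + y) ≤ L / (2 * y / (y + 2)) := by gcongr
  have h2 : L / (2 * y / (y + 2)) + L / 2 = L * (1 + y) / y := by
    field_simp
    ring
  linarith [(Int.ceil_lt_add_one (L / Real.log (1 + y))).le]

theorem descFactorial_add_repeatCount (q l : ℕ) : q.descFactorial l + repeatCount q l = q ^ l :=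
  Nat.add_sub_of_le (Nat.descFactorial_le_pow q l)

theorem repeatCount_lt_pow {q l : ℕ} (h : l ≤ q) : repeatCount q l < q ^ l := by
  have := descFactorial_add_repeatCount q l
  have := Nat.descFactorial_pos.2 h
  omega

theorem log_repeatCount_lt {q l : ℕ} (hl : 2 ≤ l) (h : l ≤ q) :
    Real.log (repeatCount q l) < l * Real.log q := by
  have := le_repeatCount (q := q) hl
  rw [← Real.log_pow]
  exact Real.log_lt_log (by exact_mod_cast (by omega)) (by exact_mod_cast repeatCount_lt_pow h)

/-- As `(k + l)! = k! * (k + l) (k + l - 1) ⋯ (k + 1)`, the factor `k!` cancels from the denominator of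
`dpConst`. -/
theorem dpConst_succ {k l : ℕ} (hl : 2 ≤ l) : dpConst (k + 1) l =
    ⌈l * Real.log (k + l : ℕ) /
      (l * Real.log (k + l : ℕ) - Real.log (repeatCount (k + l) l))⌉ := by
  have hfac : k ! * (k + l).descFactorial l = (k + l)! := by
    simpa using Nat.factorial_mul_descFactorial (Nat.le_add_left l k)
  have hsum : ((k + l).descFactorial l : ℝ) + repeatCount (k + l) l = ((k + l : ℕ) : ℝ) ^ l := by
    exact_mod_cast descFactorial_add_repeatCount (k + l) l
  have hN : (repeatCount (k + l) l : ℝ) ≠ 0 := by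
    have := le_repeatCount (q := k + l) hl
    exact_mod_cast (by omega : repeatCount (k + l) l ≠ 0)
  have hk : (k ! : ℝ) ≠ 0 := by exact_mod_cast Nat.factorial_ne_zero k
  have hcast : ((k + 1 : ℕ) : ℝ) + l - 1 = (k + l : ℕ) := by
    push_cast
    ring
  have hnat : k + 1 + l - 1 = k + l := by omega
  have harg : (k ! : ℝ) * ((k + l : ℕ) : ℝ) ^ l - ((k + l)! : ℕ) =
      k ! * repeatCount (k + l) l := by
    rw [← hsum, ← hfac]
    push_cast
    ring
  rw [dpConst, hcast, hnat, Nat.add_sub_cancel, harg, Real.log_mul hk hN]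
  congr 2
  ring

theorem dpConst_succ_le {k l : ℕ} (hk : 1 ≤ k) (hl : 2 ≤ l) :
    (dpConst (k + 1) l : ℝ) ≤
      l * k ! * Real.log (k + l : ℕ) / (k + l)! * ((k + l : ℕ) : ℝ) ^ l := by
  have hfac : k ! * (k + l).descFactorial l = (k + l)! := by
    simpa using Nat.factorial_mul_descFactorial (Nat.le_add_left l k)
  have hsum : ((k + l).descFactorial l : ℝ) + repeatCount (k + l) l = ((k + l : ℕ) : ℝ) ^ l := by
    exact_mod_cast descFactorial_add_repeatCount (k + l) l
  have hN : (0 : ℝ) < repeatCount (k + l) l := by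
    have := le_repeatCount (q := k + l) hl
    exact_mod_cast (by omega : 0 < repeatCount (k + l) l)
  have hd : (0 : ℝ) < (k + l).descFactorial l := by
    exact_mod_cast Nat.descFactorial_pos.2 (Nat.le_add_left l k)
  have hk0 : (0 : ℝ) < k ! := by exact_mod_cast Nat.factorial_pos k
  have hq : (0 : ℝ) < (k + l : ℕ) := by exact_mod_cast (by omega)
  -- `k + l ≥ 3 > e`
  have hlog : 1 ≤ Real.log (k + l : ℕ) := by
    rw [Real.le_log_iff_exp_le hq]
    have : (3 : ℝ) ≤ (k + l : ℕ) := by exact_mod_cast (by omega)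
    linarith [Real.exp_one_lt_d9]
  have hL : (2 : ℝ) ≤ l * Real.log (k + l : ℕ) := by
    have : (2 : ℝ) ≤ l := by exact_mod_cast hl
    nlinarith
  have hy : 1 + ((k + l).descFactorial l : ℝ) / repeatCount (k + l) l =
      ((k + l : ℕ) : ℝ) ^ l / repeatCount (k + l) l := by
    rw [← hsum]
    field_simp
    ring
  have h := ceil_div_log_one_add_le hL (div_pos hd hN)
  rw [hy, Real.log_div (by positivity) hN.ne', Real.log_pow] at h
  rw [dpConst_succ hl]
  refine h.trans_eq ?_
  rw [← hfac]
  push_cast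
  field_simp

end Estimates

theorem theorem1p10 {V : Type*} [Fintype V] (G : SimpleGraph V) (k l : ℕ) (hk : 2 ≤ k)
    (hcrit : G.IsKCritical k) (hDP : G.dpChromaticNumber = k) (hl : 2 ≤ l) :
    (∀ t : ℕ,
      (t : ℝ) ≥ dpConst k l * ((G.chromaticPoly (k + l - 1) : ℝ) / ((k : ℝ) + l - 1)) ^ l →
      (G □ completeBipartiteGraph (Fin l) (Fin t)).dpChromaticNumber = ((k + l : ℕ) : ℕ∞)) ∧
    (∀ t : ℕ,
      (t : ℝ) ≥ (l * ((k - 1)! : ℕ) * Real.log ((k : ℝ) + l - 1) / ((k + l - 1)! : ℕ)) *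
        (G.chromaticPoly (k + l - 1) : ℝ) ^ l →
      (G □ completeBipartiteGraph (Fin l) (Fin t)).dpChromaticNumber = ((k + l : ℕ) : ℕ∞)) := by
  obtain ⟨k, rfl⟩ : ∃ k', k = k' + 1 := ⟨k - 1, by omega⟩
  have hk1 : 1 ≤ k := by omega
  have hcol : ¬ G.Colorable k := fun h => by
    have h' := SimpleGraph.chromaticNumber_le_iff_colorable.2 h
    rw [hcrit.1] at h'
    have : k + 1 ≤ k := by exact_mod_cast h'
    omega
  obtain ⟨v₀⟩ : Nonempty V := by
    by_contra hV
    rw [not_nonempty_iff] at hV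
    exact hcol (.of_isEmpty k)
  have : NeZero (k + l) := ⟨by omega⟩
  have hnat : k + 1 + l - 1 = k + l := by omega
  have hcast : ((k + 1 : ℕ) : ℝ) + l - 1 = (k + l : ℕ) := by
    push_cast
    ring
  have hq : (0 : ℝ) < (k + l : ℕ) := by exact_mod_cast (by omega)
  rw [hnat, hcast, Nat.add_sub_cancel, G.chromaticPoly_eq_card_normalizedColoring_mul v₀ (k + l)]
  set r := Nat.card (G.NormalizedColoring (ZMod (k + l)) v₀)
  have main (t : ℕ) (ht : (dpConst (k + 1) l : ℝ) * (r : ℝ) ^ l ≤ t) :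
      (G □ completeBipartiteGraph (Fin l) (Fin t)).dpChromaticNumber =
        ((k + 1 + l : ℕ) : ℕ∞) := by
    rw [Nat.add_right_comm]
    refine SimpleGraph.dpChromaticNumber_eq_succ ?_ ?_
    · rw [Nat.add_right_comm]
      exact (SimpleGraph.dpColorable_of_dpChromaticNumber_eq hDP).boxProd_completeBipartiteGraph l t
    · have hpos := sub_pos.2 (log_repeatCount_lt hl (Nat.le_add_left l k))
      have hceil := Int.le_ceil (l * Real.log (k + l : ℕ) /
        (l * Real.log (k + l : ℕ) - Real.log (repeatCount (k + l) l)))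
      rw [← dpConst_succ hl, div_le_iff₀ hpos] at hceil
      have hlog : 0 ≤ l * Real.log (k + l : ℕ) := by positivity
      have hnn : (0 : ℝ) ≤ dpConst (k + 1) l :=
        nonneg_of_mul_nonneg_left (hlog.trans hceil) hpos
      obtain ⟨c, hc⟩ := Int.eq_ofNat_of_zero_le (by exact_mod_cast hnn : 0 ≤ dpConst (k + 1) l)
      rw [hc, Int.cast_natCast] at ht hceil
      have hN : 0 < repeatCount (k + l) l := by
        have := le_repeatCount (q := k + l) hl
        omega
      exact SimpleGraph.not_dpColorable_boxProd hl hcol v₀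
        (card_bound_of_log_le (by omega) hN hceil) (by exact_mod_cast ht)
  refine ⟨fun t ht => main t ?_, fun t ht => main t ?_⟩
  · rwa [Nat.cast_mul, mul_div_cancel_right₀ _ hq.ne'] at ht
  · refine le_trans ?_ ht
    rw [Nat.cast_mul, mul_pow, mul_comm ((r : ℝ) ^ l), ← mul_assoc]
    gcongr
    exact dpConst_succ_le hk1 hl
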